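/- Consider two-table cuckoo hashing with a stash: there are two subtables with $m$ cells each, and $q\le(1-\varepsilon)m$ distinct keys, where $\varepsilon\in(0,1)$ is a constant. Each cell holds at most one key, and the two hash functions $h_1,h_2$ are independent and fully random. Each key $x$ is stored in cell $h_1(x)$ of the first subtable, in cell $h_2(x)$ of the second subtable, or in the stash. The stash of size $s$ overflows if the keys cannot be stored in this way with at most $s$ keys in the stash. The cuckoo graph $G$ is the bipartite multigraph on the cells that has one edge $\{h_1(x),h_2(x)\}$ for each key $x$. Let $\gamma(G)$ be the smallest number of edges whose removal leaves no cycle, and let $T(G)$ be the number of connected components of $G$ that contain a cycle. Fix constants $\varepsilon\in(0,1)$, $c_0>0$, $A\in\mathbb R$, $B\in\mathbb N$, $c_1>0$ and $c_2\in\mathbb R$. There is a constant $\alpha>0$, depending only on these, such that for all sufficiently large $n$ and all natural numbers $m,s,q$ with $$c_0\log^7 n\le m\le A\log^B n,\qquad c_1\log n\le s\le c_2\log n,\qquad q\le(1-\varepsilon)m,$$ we have $$\Pr\bigl(\gamma(G)-T(G)\ge s\bigr)\le m^{-\alpha s}\qquad\text{and}\qquad \Pr(\text{the stash of size } s \text{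 overflows})\le m^{-\alpha s}.$$ Moreover this bound is superpolynomially small in $n$: for every $D$ there is $N$ such that $m^{-\alpha s}\le n^{-D}$ for all $n\ge N$ and all $m,s$ in these ranges. -/

import Mathlib

/-! ### Cycles, cyclomatic number and cyclic components of a multigraph -/

/-- `G` contains a cycle: `k + 1` distinct vertices and `k + 1` distinct edges in cyclic order
(indices modulo `k + 1`). A loop (`k = 0`) and a pair of parallel edges (`k = 1`) are cycles. -/
def Graph.HasCycle {V E : Type*} (G : Graph V E) : Prop :=
  ∃ (k : ℕ) (v : Fin (k + 1) → V) (e : Fin (k + 1) → E),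
    Function.Injective v ∧ Function.Injective e ∧ ∀ i, G.IsLink (e i) (v i) (v (i + 1))

/-- `γ(G)`: the smallest number of edges whose removal leaves no cycle. -/
noncomputable def Graph.cyclomaticNumber {V E : Type*} (G : Graph V E) : ℕ :=
  sInf {k : ℕ | ∃ F : Finset E, (F : Set E) ⊆ G.edgeSet ∧ F.card = k ∧
    ¬ (G.deleteEdges (F : Set E)).HasCycle}

/-- The vertex set of the connected component of `v`. -/
def Graph.componentSet {V E : Type*} (G : Graph V E) (v : V) : Set V :=
  {w | Relation.ReflTransGen G.Adj v w}

/-- `T(G)`: the number of connected components of `G` that contain a cycle. -/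
noncomputable def Graph.numCyclicComponents {V E : Type*} (G : Graph V E) : ℕ :=
  {C : Set V | (∃ v ∈ G.vertexSet, C = G.componentSet v) ∧ (G.induce C).HasCycle}.ncard

/-! ### Two-table cuckoo hashing with a stash -/

/-- The values of the two hash functions `h.1`, `h.2` on `q` distinct keys (indexed by `Fin q`);
each of the two subtables has `m` cells. -/
abbrev HashPair (m q : ℕ) : Type := (Fin q → Fin m) × (Fin q → Fin m)

/-- The cells of the two subtables: `Sum.inl i` in the first table, `Sum.inr j` in the second. -/
abbrev CuckooCell (m : ℕ) : Type := Fin m ⊕ Fin m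

/-- The cuckoo graph: a bipartite multigraph whose vertices are the cells that are hash values of
keys, with one edge, joining `h.1 x` to `h.2 x`, for each key `x`. -/
def cuckooGraph {m q : ℕ} (h : HashPair m q) : Graph (CuckooCell m) (Fin q) where
  vertexSet := Set.range (fun x => Sum.inl (h.1 x)) ∪ Set.range (fun x => Sum.inr (h.2 x))
  edgeSet := Set.univ
  IsLink x a b := (a = Sum.inl (h.1 x) ∧ b = Sum.inr (h.2 x)) ∨
    (a = Sum.inr (h.2 x) ∧ b = Sum.inl (h.1 x))
  isLink_symm := by
    refine fun x _ => ⟨?_⟩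
    rintro a b (⟨rfl, rfl⟩ | ⟨rfl, rfl⟩)
    · exact Or.inr ⟨rfl, rfl⟩
    · exact Or.inl ⟨rfl, rfl⟩
  eq_or_eq_of_isLink_of_isLink := by
    rintro x a b c d (⟨rfl, rfl⟩ | ⟨rfl, rfl⟩) (⟨rfl, rfl⟩ | ⟨rfl, rfl⟩) <;> simp
  left_mem_of_isLink := by
    rintro x a b (⟨rfl, rfl⟩ | ⟨rfl, rfl⟩)
    · exact Or.inl ⟨x, rfl⟩
    · exact Or.inr ⟨x, rfl⟩
  edge_mem_iff_exists_isLink := by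
    intro x
    exact ⟨fun _ => ⟨_, _, Or.inl ⟨rfl, rfl⟩⟩, fun _ => Set.mem_univ x⟩

/-- The keys can be stored using a stash of capacity `s`: at most `s` keys go to the stash, and
every other key `x` goes to one of its two cells, at most one key per cell. -/
def FitsWithStash {m q : ℕ} (h : HashPair m q) (s : ℕ) : Prop :=
  ∃ (S : Finset (Fin q)) (cell : Fin q → CuckooCell m), S.card ≤ s ∧
    (∀ x, x ∉ S → cell x = Sum.inl (h.1 x) ∨ cell x = Sum.inr (h.2 x)) ∧
    (∀ x y, x ∉ S → y ∉ S → cell x = cell y → x = y)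

/-- The probability of an event when `h.1` and `h.2` are independent, fully random functions. -/
noncomputable def hashProb (m q : ℕ) (A : Set (HashPair m q)) : ℝ :=
  (ProbabilityTheory.uniformOn (Set.univ : Set (HashPair m q))).real A

/-! Both events force a deficient set `K` of keys: `|h₁(K)| + |h₂(K)| + s ≤ |K|`. For overflow this
is Hall's theorem with defect `s`. For `γ - T ≥ s`, let `K` be the edges of the cyclic components:
deleting those outside a spanning forest kills every cycle, so `γ ≤ |K| - |V(K)| + T`.

A smallest deficient `K` has equality and hits each of its cells at least twice
(`exists_two_le_card_filter`). With `k = |K|` and `a`, `b` cells, a union bound remains. Double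
hitting limits the maps from `K` onto the `a` cells to `k! a^(k-2a) / 2^a`
(`card_fibers_two_le_mul_two_pow`). The saved `2^(a+b)` pays for the binomial coefficient in `k! ≤
2^(a+b) a! b! k^s`, and since `a + b = k - s` each term is at most `(q/m)^k k^(3s) / m^s`
(`card_core_term_le`).

The load bound gives `(q/m)^k ≤ exp(-εk)`, so the numerator is at most `(3s/ε)^(3s)`. As `s = O(log
n)` and `m = Ω(log⁷ n)`, this is about `m^(3s/7)` up to a factor `C^s`, leaving room for the
exponent `-s/7`. Since `s = Ω(log n)` and `m → ∞`, the bound is superpolynomially small. -/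

namespace Graph

/-! ### Spanning forests and the cyclomatic number -/

variable {V E : Type*} {G : Graph V E}

lemma mem_componentSet_self (v : V) : v ∈ G.componentSet v := Relation.ReflTransGen.refl

lemma Adj.componentSet_eq {v w : V} (h : G.Adj v w) : G.componentSet v = G.componentSet w := by
  ext u
  exact ⟨fun hu => Relation.ReflTransGen.head h.symm hu, fun hu => Relation.ReflTransGen.head h hu⟩

/-- Every vertex of the component of `r` other than `r` has a neighbour that is closer to `r`. -/
lemma exists_depth (G : Graph V E) (r : V) :
    ∃ d : V → ℕ, ∀ v ∈ G.componentSet r, v ≠ r → ∃ w, d w < d v ∧ G.Adj w v := by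
  -- `R n` holds the ends of walks of length `n` from `r`, so the depth is the distance to `r`.
  let R : ℕ → Set V := fun n => Nat.rec {r} (fun _ S => {v | ∃ u ∈ S, G.Adj u v}) n
  refine ⟨fun v => sInf {n | v ∈ R n}, fun v hv hvr => ?_⟩
  have hne : {n | v ∈ R n}.Nonempty := by
    induction hv with
    | refl => exact absurd rfl hvr
    | @tail b c _ hbc ih =>
      by_cases hb : b = r
      · exact ⟨1, b, hb, hbc⟩
      · obtain ⟨n, hn⟩ := ih hb
        exact ⟨n + 1, b, hn, hbc⟩
  have hmem := Nat.sInf_mem hne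
  rcases hd : sInf {n | v ∈ R n} with _ | j
  · rw [hd] at hmem
    exact absurd hmem hvr
  · rw [hd] at hmem
    obtain ⟨u, hu, huv⟩ := hmem
    refine ⟨u, ?_, huv⟩
    change sInf {n | u ∈ R n} < sInf {n | v ∈ R n}
    rw [hd]
    exact Nat.lt_succ_of_le (Nat.sInf_le hu)

/-- A rooted spanning forest: a root in each component, and for every other vertex an edge to a
vertex of smaller depth. -/
lemma exists_rooted_forest (G : Graph V E) :
    ∃ (root : Set V) (d : V → ℕ) (p : {v // v ∉ root} → E),
      (∀ v ∈ root, ∀ w ∈ root, G.componentSet v = G.componentSet w → v = w) ∧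
      ∀ v : {v // v ∉ root}, ∃ w, d w < d v ∧ G.IsLink (p v) w v := by
  choose d hd using G.exists_depth
  let rt : V → V := fun v =>
    Set.Nonempty.some (s := G.componentSet v) ⟨v, mem_componentSet_self v⟩
  have hrt : ∀ v, rt v ∈ G.componentSet v := fun v => Set.Nonempty.some_mem _
  have hsome : ∀ (C D : Set V) (hC : C.Nonempty) (hD : D.Nonempty), C = D → hC.some = hD.some := by
    rintro C D hC hD rfl
    rfl
  have heq : ∀ v w, G.componentSet v = G.componentSet w → rt v = rt w := fun v w h =>
    hsome _ _ _ _ h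
  have hcomp : ∀ v w, w ∈ G.componentSet v → G.componentSet v = G.componentSet w := by
    intro v w h
    induction h with
    | refl => rfl
    | tail _ h ih => rw [ih, h.componentSet_eq]
  have hex : ∀ v : {v // v ∉ {v | rt v = v}}, ∃ e w, d (rt w) w < d (rt v) v ∧ G.IsLink e w v := by
    rintro ⟨v, hv⟩
    have hvr : v ∈ G.componentSet (rt v) := by
      rw [← hcomp v _ (hrt v)]
      exact mem_componentSet_self v
    obtain ⟨w, hw, e, he⟩ := hd (rt v) v hvr (fun h => hv h.symm)
    refine ⟨e, w, ?_, he⟩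
    rwa [heq w v (IsLink.adj he).componentSet_eq]
  choose p hp using hex
  exact ⟨{v | rt v = v}, fun v => d (rt v) v, p,
    fun v hv w hw h => by rw [← hv, ← hw]; exact heq v w h, hp⟩

/-- Removing the edges outside a spanning forest from the components that contain a cycle leaves no
cycle. -/
lemma exists_cyclomaticNumber_add_card_le [Fintype V] [Fintype E] (G : Graph V E) :
    ∃ K : Finset E, ∀ U : Finset V, (∀ v ∈ U, ∃ e ∈ K, G.Inc e v) →
      (∀ e ∈ K, ∀ v, G.Inc e v → v ∈ U) →
      G.cyclomaticNumber + U.card ≤ K.card + G.numCyclicComponents := by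
  classical
  obtain ⟨root, d, p, hroot, hp⟩ := G.exists_rooted_forest
  -- A shared parent edge would have each of its two ends strictly deeper than the other.
  have hpinj : Function.Injective p := by
    intro v w h
    obtain ⟨v', hv', lv⟩ := hp v
    obtain ⟨w', hw', lw⟩ := hp w
    rw [h] at lv
    rcases lv.eq_and_eq_or_eq_and_eq lw with ⟨-, h2⟩ | ⟨h1, h2⟩
    · exact Subtype.ext h2
    · rw [← h1] at hw'
      rw [← h2] at hw'
      omega
  let K : Finset E := {e | ∃ v, G.Inc e v ∧ (G.induce (G.componentSet v)).HasCycle}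
  refine ⟨K, fun U hU hU' => ?_⟩
  have hcyc : ∀ v ∈ U, (G.induce (G.componentSet v)).HasCycle := by
    intro v hv
    obtain ⟨e, he, w, hw⟩ := hU v hv
    obtain ⟨u, hu, hc⟩ := (Finset.mem_filter.1 he).2
    rcases hu.eq_or_eq_of_isLink hw with rfl | rfl
    · exact hc
    · rwa [hw.adj.componentSet_eq]
  have hKmem : ∀ {e v}, G.Inc e v → (G.induce (G.componentSet v)).HasCycle → e ∈ K :=
    fun he hc => Finset.mem_filter.2 ⟨Finset.mem_univ _, _, he, hc⟩
  let P : Finset E := ({v : {v // v ∉ root} | v.1 ∈ U} : Finset _).image p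
  have hPK : P ⊆ K := by
    intro e he
    obtain ⟨v, hv, rfl⟩ := Finset.mem_image.1 he
    obtain ⟨w, -, lw⟩ := hp v
    exact hKmem lw.inc_right (hcyc _ (Finset.mem_filter.1 hv).2)
  have hPcard : P.card = (U.filter (· ∉ root)).card := by
    rw [Finset.card_image_of_injective _ hpinj]
    refine Finset.card_bij (fun v _ => v.1) ?_ ?_ ?_
    · intro v hv
      exact Finset.mem_filter.2 ⟨(Finset.mem_filter.1 hv).2, v.2⟩
    · intro v _ w _ h
      exact Subtype.ext h
    · intro v hv
      obtain ⟨h1, h2⟩ := Finset.mem_filter.1 hv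
      exact ⟨⟨v, h2⟩, Finset.mem_filter.2 ⟨Finset.mem_univ _, h1⟩, rfl⟩
  have hT : (U.filter (· ∈ root)).card ≤ G.numCyclicComponents := by
    rw [← Set.ncard_coe_finset, numCyclicComponents]
    refine Set.ncard_le_ncard_of_injOn G.componentSet ?_ ?_ (Set.toFinite _)
    · intro v hv
      have hvU := (Finset.mem_filter.1 hv).1
      obtain ⟨e, -, he⟩ := hU v hvU
      exact ⟨⟨v, he.vertex_mem, rfl⟩, hcyc v hvU⟩
    · intro v hv w hw h
      exact hroot v (Finset.mem_filter.1 hv).2 w (Finset.mem_filter.1 hw).2 h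
  have hγ : G.cyclomaticNumber ≤ (K \ P).card := by
    refine Nat.sInf_le ⟨K \ P, ?_, rfl, ?_⟩
    · intro e he
      obtain ⟨v, hv, -⟩ := (Finset.mem_filter.1 (Finset.mem_sdiff.1 he).1).2
      exact hv.edge_mem
    · rintro ⟨k, v, e, hv, he, hl⟩
      have hlG : ∀ i, G.IsLink (e i) (v i) (v (i + 1)) := fun i => (hl i).1
      have hcomp : ∀ i, G.componentSet (v i) = G.componentSet (v 0) := by
        intro i
        induction i using Fin.induction with
        | zero => rfl
        | succ i ih =>
          rw [← ih, (hlG i.castSucc).adj.componentSet_eq, Fin.coeSucc_eq_succ]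
      have hC : ∀ i, (G.induce (G.componentSet (v i))).HasCycle := by
        intro i
        refine ⟨k, v, e, hv, he, fun j => ⟨hlG j, ?_, ?_⟩⟩
        · rw [hcomp i, ← hcomp j]
          exact mem_componentSet_self _
        · rw [hcomp i, ← hcomp (j + 1)]
          exact mem_componentSet_self _
      have hPi : ∀ i, ∃ u, p u = e i := by
        intro i
        have h1 : e i ∈ K := hKmem (hlG i).inc_left (hC i)
        have h2 : e i ∉ K \ P := (hl i).2
        have h3 : e i ∈ P := by
          by_contra h
          exact h2 (Finset.mem_sdiff.2 ⟨h1, h⟩)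
        obtain ⟨u, -, hu⟩ := Finset.mem_image.1 h3
        exact ⟨u, hu⟩
      -- At a deepest vertex of the cycle, both cycle edges must be its parent edge. They then
      -- coincide, so the cycle is a loop, but a parent edge strictly changes depth.
      obtain ⟨i, hi⟩ := Finite.exists_max (fun i => d (v i))
      have key : ∀ j x, G.IsLink (e j) (v i) x → d x ≤ d (v i) →
          d x < d (v i) ∧ ∃ u, u.1 = v i ∧ p u = e j := by
        intro j x hx hdx
        obtain ⟨u, hu⟩ := hPi j
        obtain ⟨w, hw, lw⟩ := hp u
        rw [hu] at lw
        rcases hx.eq_and_eq_or_eq_and_eq lw with ⟨h1, h2⟩ | ⟨h1, h2⟩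
        · rw [h1, h2] at hdx
          omega
        · rw [h1, h2]
          exact ⟨hw, u, rfl, hu⟩
      obtain ⟨hlt, u, hu, hpu⟩ := key i _ (hlG i) (hi _)
      have hprev := hlG (i - 1)
      rw [sub_add_cancel] at hprev
      obtain ⟨-, u', hu', hpu'⟩ := key (i - 1) _ hprev.symm (hi _)
      have huu : u = u' := Subtype.ext (hu.trans hu'.symm)
      have hii : i = i - 1 := he (by rw [← hpu, ← hpu', huu])
      have : i + 1 = i := by
        nth_rewrite 1 [hii]
        exact sub_add_cancel i 1
      rw [this] at hlt
      exact lt_irrefl _ hlt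
  have h1 := Finset.card_sdiff_add_card_eq_card hPK
  have h2 := Finset.card_filter_add_card_filter_not (s := U) (· ∈ root)
  omega

end Graph

/-! ### Counting functions with fibres of size at least two -/

open Nat in
/-- Functions all of whose fibres have at least two elements are obtained from an enumeration of
the domain that begins with two elements of each fibre. -/
lemma card_fibers_two_le_mul_two_pow {ι A : Type*} [Fintype ι] [Fintype A] [DecidableEq ι]
    [DecidableEq A] :
    Fintype.card {f : ι → A // ∀ a, 2 ≤ Fintype.card {x // f x = a}} * 2 ^ Fintype.card A ≤
      (Fintype.card ι)! * Fintype.card A ^ (Fintype.card ι - 2 * Fintype.card A) := by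
  classical
  set d := Fintype.card ι - 2 * Fintype.card A with hd
  have hex : ∀ f : {f : ι → A // ∀ a, 2 ≤ Fintype.card {x // f x = a}},
      ∃ π : (A × Bool) ⊕ Fin d ≃ ι, ∀ y, f.1 (π (Sum.inl y)) = y.1 := by
    rintro ⟨f, hf⟩
    have hj : ∀ a, Nonempty (Bool ↪ {x // f x = a}) := fun a =>
      Function.Embedding.nonempty_of_card_le (by simpa using hf a)
    let j := fun a => (hj a).some
    have hinj : Function.Injective (fun y : A × Bool => (j y.1 y.2 : ι)) := by
      rintro ⟨a, b⟩ ⟨a', b'⟩ h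
      have ha : a = a' := by
        rw [← (j a b).2, ← (j a' b').2]
        exact congrArg f h
      subst ha
      exact Prod.ext rfl ((j a).injective (Subtype.ext h))
    let r := Set.range (fun y : A × Bool => (j y.1 y.2 : ι))
    have hr : Fintype.card r = 2 * Fintype.card A := by
      rw [Set.card_range_of_injective hinj, Fintype.card_prod, Fintype.card_bool, mul_comm]
    have hc : Fintype.card (Fin d) = Fintype.card (rᶜ : Set ι) := by
      rw [Fintype.card_fin, Fintype.card_compl_set, hr]
    refine ⟨(Equiv.sumCongr (Equiv.ofInjective _ hinj) (Fintype.equivOfCardEq hc)).trans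
      (Equiv.Set.sumCompl r), fun y => ?_⟩
    simpa using (j y.1 y.2).2
  choose π hπ using hex
  -- Swapping the chosen pair in any subset of the fibres gives `2 ^ |A|` enumerations for one `f`.
  -- An enumeration and the values at its last `d` places determine `f`, and then the swaps.
  let flip : (A → Bool) → ((A × Bool) ⊕ Fin d ≃ (A × Bool) ⊕ Fin d) := fun ε =>
    Equiv.sumCongr (Function.Involutive.toPerm (fun y => (y.1, xor y.2 (ε y.1)))
      (fun y => by simp)) (Equiv.refl _)
  let Φ : {f : ι → A // ∀ a, 2 ≤ Fintype.card {x // f x = a}} × (A → Bool) →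
      ((A × Bool) ⊕ Fin d ≃ ι) × (Fin d → A) := fun y =>
    ((flip y.2).trans (π y.1), fun i => y.1.1 (π y.1 (Sum.inr i)))
  have hrec : ∀ y z, y.1.1 ((Φ y).1 z) = Sum.elim Prod.fst (Φ y).2 z := by
    rintro y (z | z)
    · simp [Φ, flip, hπ, Function.Involutive.toPerm]
    · simp [Φ, flip]
  have hΦ : Function.Injective Φ := by
    rintro ⟨f, ε⟩ ⟨f', ε'⟩ h
    have hf : f = f' := by
      refine Subtype.ext (funext fun x => ?_)
      have h1 := hrec (f, ε) ((Φ (f, ε)).1.symm x)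
      have h2 := hrec (f', ε') ((Φ (f, ε)).1.symm x)
      rw [← h, ← h1] at h2
      simpa using h2.symm
    subst hf
    have hfl : ∀ z, flip ε z = flip ε' z := fun z =>
      (π f).injective (DFunLike.congr_fun (congrArg Prod.fst h) z)
    have : ε = ε' := by
      funext a
      simpa [flip, Function.Involutive.toPerm] using hfl (Sum.inl (a, false))
    rw [this]
  by_cases hne : IsEmpty {f : ι → A // ∀ a, 2 ≤ Fintype.card {x // f x = a}}
  · simp
  · obtain ⟨f⟩ := not_isEmpty_iff.1 hne
    have := Fintype.card_le_of_injective Φ hΦ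
    rw [Fintype.card_prod, Fintype.card_prod, Fintype.card_equiv (π f), Fintype.card_fun,
      Fintype.card_fun, Fintype.card_congr (π f), Fintype.card_bool, Fintype.card_fin] at this
    exact this

/-- The functions that map `K` into `A`, at least two elements of `K` to each element of `A`. -/
def twoCovering {α β : Type*} [Fintype α] [Fintype β] [DecidableEq α] [DecidableEq β]
    (K : Finset α) (A : Finset β) : Finset (α → β) :=
  {f : α → β | (∀ x ∈ K, f x ∈ A) ∧ ∀ a ∈ A, 2 ≤ (K.filter (f · = a)).card}

lemma mem_twoCovering {α β : Type*} [Fintype α] [Fintype β] [DecidableEq α] [DecidableEq β]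
    {K : Finset α} {A : Finset β} {f : α → β} : f ∈ twoCovering K A ↔
      (∀ x ∈ K, f x ∈ A) ∧ ∀ a ∈ A, 2 ≤ (K.filter (f · = a)).card := by
  simp [twoCovering]

open Nat in
-- The fibre count applies to the restriction to `K`; the values off `K` are free.
lemma card_twoCovering_le {α β : Type*} [Fintype α] [Fintype β] [DecidableEq α] [DecidableEq β]
    (K : Finset α) (A : Finset β) :
    (twoCovering K A).card * 2 ^ A.card ≤
      K.card ! * A.card ^ (K.card - 2 * A.card) *
        Fintype.card β ^ (Fintype.card α - K.card) := by
  classical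
  have hle : (twoCovering K A).card ≤
      Fintype.card {f : K → A // ∀ a, 2 ≤ Fintype.card {x // f x = a}} *
        Fintype.card ({x // x ∉ K} → β) := by
    rw [← Fintype.card_prod, ← Fintype.card_coe]
    refine Fintype.card_le_of_injective
      (fun f => (⟨fun x => ⟨f.1 x, (mem_twoCovering.1 f.2).1 x x.2⟩, ?_⟩, fun x => f.1 x)) ?_
    · intro a
      refine ((mem_twoCovering.1 f.2).2 a a.2).trans ?_
      rw [← Fintype.card_coe]
      refine Fintype.card_le_of_injective (fun x => ⟨⟨x.1, (Finset.mem_filter.1 x.2).1⟩,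
        Subtype.ext (Finset.mem_filter.1 x.2).2⟩) ?_
      intro x y h
      exact Subtype.ext (congrArg (fun z => (z.1.1 : α)) h)
    · intro f g h
      obtain ⟨h1, h2⟩ := Prod.mk.inj h
      refine Subtype.ext (funext fun x => ?_)
      by_cases hx : x ∈ K
      · exact congrArg Subtype.val (congrFun (congrArg Subtype.val h1) ⟨x, hx⟩)
      · exact congrFun h2 ⟨x, hx⟩
  have h := card_fibers_two_le_mul_two_pow (ι := K) (A := A)
  rw [Fintype.card_coe, Fintype.card_coe] at h
  have hc : Fintype.card ({x // x ∉ K} → β) = Fintype.card β ^ (Fintype.card α - K.card) := by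
    rw [Fintype.card_fun, Fintype.card_subtype_compl, Fintype.card_coe]
  rw [hc] at hle
  calc _ ≤ _ := Nat.mul_le_mul_right _ hle
    _ = (Fintype.card {f : K → A // ∀ a, 2 ≤ Fintype.card {x // f x = a}} * 2 ^ A.card) *
        Fintype.card β ^ (Fintype.card α - K.card) := by ring
    _ ≤ _ := Nat.mul_le_mul_right _ h

/-! ### From the two events to a minimal deficient set of keys -/

lemma cuckooGraph_inc_iff {m q : ℕ} (h : HashPair m q) (x : Fin q) (c : CuckooCell m) :
    (cuckooGraph h).Inc x c ↔ c = Sum.inl (h.1 x) ∨ c = Sum.inr (h.2 x) := by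
  constructor
  · rintro ⟨_, ⟨hc, -⟩ | ⟨hc, -⟩⟩
    · exact Or.inl hc
    · exact Or.inr hc
  · rintro (hc | hc)
    · exact ⟨_, Or.inl ⟨hc, rfl⟩⟩
    · exact ⟨_, Or.inr ⟨hc, rfl⟩⟩

/-- A large cyclomatic number yields a set of keys with few cells. -/
lemma exists_card_image_add_le_of_cyclomaticNumber {m q s : ℕ} (h : HashPair m q)
    (hs : s + (cuckooGraph h).numCyclicComponents ≤ (cuckooGraph h).cyclomaticNumber) :
    ∃ K : Finset (Fin q), (K.image h.1).card + (K.image h.2).card + s ≤ K.card := by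
  obtain ⟨K, hK⟩ := (cuckooGraph h).exists_cyclomaticNumber_add_card_le
  have := hK ((K.image h.1).disjSum (K.image h.2)) ?_ ?_
  · rw [Finset.card_disjSum] at this
    exact ⟨K, by omega⟩
  · rintro (c | c) hc
    · obtain ⟨x, hx, rfl⟩ := Finset.mem_image.1 (Finset.inl_mem_disjSum.1 hc)
      exact ⟨x, hx, (cuckooGraph_inc_iff ..).2 (Or.inl rfl)⟩
    · obtain ⟨x, hx, rfl⟩ := Finset.mem_image.1 (Finset.inr_mem_disjSum.1 hc)
      exact ⟨x, hx, (cuckooGraph_inc_iff ..).2 (Or.inr rfl)⟩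
  · intro x hx c hc
    rcases (cuckooGraph_inc_iff ..).1 hc with rfl | rfl
    · exact Finset.inl_mem_disjSum.2 (Finset.mem_image_of_mem _ hx)
    · exact Finset.inr_mem_disjSum.2 (Finset.mem_image_of_mem _ hx)

/-- The defect version of Hall's theorem for the stash. -/
lemma exists_card_image_add_le_of_not_fitsWithStash {m q s : ℕ} (h : HashPair m q)
    (hs : ¬ FitsWithStash h s) :
    ∃ K : Finset (Fin q), (K.image h.1).card + (K.image h.2).card + s ≤ K.card := by
  classical
  by_contra! hK
  -- The stash becomes `s` extra cells open to every key, which turns the defect version into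
  -- ordinary Hall.
  let t : Fin q → Finset (CuckooCell m ⊕ Fin s) := fun x =>
    ({Sum.inl (h.1 x), Sum.inr (h.2 x)} : Finset (CuckooCell m)).disjSum Finset.univ
  have hHall : ∀ K : Finset (Fin q), K.card ≤ (K.biUnion t).card := by
    intro K
    rcases K.eq_empty_or_nonempty with rfl | ⟨x₀, hx₀⟩
    · simp
    · have hsub : ((K.image h.1).disjSum (K.image h.2)).disjSum (Finset.univ : Finset (Fin s)) ⊆
          K.biUnion t := by
        rintro ((c | c) | i) hc
        · simp only [Finset.inl_mem_disjSum, Finset.mem_image] at hc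
          obtain ⟨x, hx, rfl⟩ := hc
          exact Finset.mem_biUnion.2 ⟨x, hx, by simp [t]⟩
        · simp only [Finset.inl_mem_disjSum, Finset.inr_mem_disjSum, Finset.mem_image] at hc
          obtain ⟨x, hx, rfl⟩ := hc
          exact Finset.mem_biUnion.2 ⟨x, hx, by simp [t]⟩
        · exact Finset.mem_biUnion.2 ⟨x₀, hx₀, by simp [t]⟩
      have h1 := Finset.card_le_card hsub
      rw [Finset.card_disjSum, Finset.card_disjSum, Finset.card_univ, Fintype.card_fin] at h1
      exact (hK K).le.trans h1
  obtain ⟨f, hf, hft⟩ := (Finset.all_card_le_biUnion_card_iff_exists_injective t).1 hHall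
  refine hs ⟨Finset.univ.filter fun x => (f x).isRight, fun x => (f x).elim id fun _ => Sum.inl (h.1 x), ?_, ?_, ?_⟩
  · have h1 : (Finset.univ.filter fun x => (f x).isRight).image f ⊆
        Finset.univ.map (⟨Sum.inr, Sum.inr_injective⟩ : Fin s ↪ CuckooCell m ⊕ Fin s) := by
      intro y hy
      obtain ⟨x, hx, rfl⟩ := Finset.mem_image.1 hy
      obtain ⟨i, hi⟩ := Sum.isRight_iff.1 (Finset.mem_filter.1 hx).2
      rw [hi]
      exact Finset.mem_map.2 ⟨i, Finset.mem_univ _, rfl⟩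
    have h2 := Finset.card_le_card h1
    rwa [Finset.card_image_of_injective _ hf, Finset.card_map, Finset.card_univ,
      Fintype.card_fin] at h2
  · intro x hx
    have h1 := hft x
    rcases hfx : f x with c | i
    · rw [hfx] at h1
      simpa [t, hfx] using h1
    · simp [hfx] at hx
  · intro x y hx hy hxy
    apply hf
    rcases hfx : f x with c | i
    · rcases hfy : f y with c' | i
      · simpa [hfx, hfy] using hxy
      · simp [hfy] at hy
    · simp [hfx] at hx

lemma Finset.card_image_erase_lt {α β : Type*} [DecidableEq α] [DecidableEq β] {K : Finset α}
    {f : α → β} {x : α} (hx : x ∈ K) (h : (K.filter (f · = f x)).card < 2) :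
    ((K.erase x).image f).card < (K.image f).card := by
  refine Finset.card_lt_card (Finset.ssubset_iff_of_subset
    (Finset.image_subset_image (Finset.erase_subset _ _)) |>.2
      ⟨f x, Finset.mem_image_of_mem _ hx, fun hmem => ?_⟩)
  obtain ⟨y, hy, hyx⟩ := Finset.mem_image.1 hmem
  have h1 := Finset.card_le_one.1 (Nat.lt_succ_iff.1 h) x (Finset.mem_filter.2 ⟨hx, rfl⟩) y
    (Finset.mem_filter.2 ⟨Finset.mem_of_mem_erase hy, hyx⟩)
  exact Finset.ne_of_mem_erase hy h1.symm

/-- A smallest set of keys with few cells meets each of its cells at least twice. -/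
lemma exists_two_le_card_filter {m q s : ℕ} (h : HashPair m q)
    (hK : ∃ K : Finset (Fin q), (K.image h.1).card + (K.image h.2).card + s ≤ K.card)
    (hs : 0 < s) :
    ∃ K : Finset (Fin q), (K.image h.1).card + (K.image h.2).card + s = K.card ∧
      (∀ c ∈ K.image h.1, 2 ≤ (K.filter (h.1 · = c)).card) ∧
      ∀ c ∈ K.image h.2, 2 ≤ (K.filter (h.2 · = c)).card := by
  classical
  obtain ⟨K, hK, hmin⟩ := Finset.exists_min_image
    (Finset.univ.filter fun K : Finset (Fin q) =>
      (K.image h.1).card + (K.image h.2).card + s ≤ K.card) Finset.card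
    (hK.imp fun K hK => Finset.mem_filter.2 ⟨Finset.mem_univ _, hK⟩)
  replace hK := (Finset.mem_filter.1 hK).2
  -- By minimality, erasing a key destroys deficiency. A key alone in a cell would take that cell
  -- with it and preserve deficiency.
  have herase : ∀ x ∈ K,
      K.card ≤ ((K.erase x).image h.1).card + ((K.erase x).image h.2).card + s := by
    intro x hx
    by_contra! hlt
    have h1 := Finset.card_erase_add_one hx
    have h2 := hmin (K.erase x) (Finset.mem_filter.2 ⟨Finset.mem_univ _, by omega⟩)
    omega
  have hmono : ∀ (f : Fin q → Fin m) (x : Fin q),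
      ((K.erase x).image f).card ≤ (K.image f).card := fun f x =>
    Finset.card_le_card (Finset.image_subset_image (Finset.erase_subset _ _))
  refine ⟨K, le_antisymm hK ?_, ?_, ?_⟩
  · obtain ⟨x, hx⟩ := Finset.card_pos.1 (show 0 < K.card by omega)
    have := herase x hx
    have := hmono h.1 x
    have := hmono h.2 x
    omega
  · intro c hc
    obtain ⟨x, hx, rfl⟩ := Finset.mem_image.1 hc
    by_contra! hlt
    have := herase x hx
    have := hmono h.2 x
    have := Finset.card_image_erase_lt hx hlt
    omega
  · intro c hc
    obtain ⟨x, hx, rfl⟩ := Finset.mem_image.1 hc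
    by_contra! hlt
    have := herase x hx
    have := hmono h.1 x
    have := Finset.card_image_erase_lt hx hlt
    omega

/-! ### The union bound over minimal deficient sets -/

lemma two_mul_card_le_of_twoCovering {α β : Type*} [Fintype α] [Fintype β] [DecidableEq α]
    [DecidableEq β] {K : Finset α} {A : Finset β} {f : α → β} (hf : f ∈ twoCovering K A) :
    2 * A.card ≤ K.card := by
  obtain ⟨h1, h2⟩ := mem_twoCovering.1 hf
  rw [Finset.card_eq_sum_card_fiberwise h1, mul_comm]
  simpa using Finset.sum_le_sum h2

open Nat in
/-- The union bound over the sets of `k` keys with `a` cells in the first table. -/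
lemma card_core_term_le {m q s k a b : ℕ} (hm : 0 < m) (hkq : k ≤ q) (hab : a + b + s = k)
    (ha : 2 * a ≤ k) (hb : 2 * b ≤ k) :
    (q.choose k * m.choose a * m.choose b : ℝ) *
      ((k ! * a ^ (k - 2 * a) * m ^ (q - k) / 2 ^ a) *
        (k ! * b ^ (k - 2 * b) * m ^ (q - k) / 2 ^ b)) ≤
      (m : ℝ) ^ (2 * q) * (((q : ℝ) / m) ^ k * k ^ (3 * s) / m ^ s) := by
  have hm' : (0 : ℝ) < m := by exact_mod_cast hm
  have h1 := Nat.choose_le_pow_div (α := ℝ) k q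
  have h2 := Nat.choose_le_pow_div (α := ℝ) a m
  have h3 := Nat.choose_le_pow_div (α := ℝ) b m
  have hf : (k ! : ℝ) ≤ 2 ^ (a + b) * (a ! * b !) * k ^ s := by
    have e1 : k ! = (a + b)! * (a + b + 1).ascFactorial s := by
      rw [Nat.factorial_mul_ascFactorial, hab]
    have e2 := Nat.ascFactorial_le_pow_add (a + b) s
    rw [hab] at e2
    have e3 := Nat.choose_le_two_pow (a + b) b
    have e4 := Nat.add_choose_mul_factorial_mul_factorial a b
    have : k ! ≤ 2 ^ (a + b) * (a ! * b !) * k ^ s := by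
      rw [e1, ← e4, mul_assoc (Nat.choose _ _)]
      exact Nat.mul_le_mul (Nat.mul_le_mul_right _ e3) e2
    exact_mod_cast this
  have hak : (a : ℝ) ^ (k - 2 * a) ≤ k ^ (k - 2 * a) :=
    pow_le_pow_left₀ (Nat.cast_nonneg _) (by exact_mod_cast (by omega)) _
  have hbk : (b : ℝ) ^ (k - 2 * b) ≤ k ^ (k - 2 * b) :=
    pow_le_pow_left₀ (Nat.cast_nonneg _) (by exact_mod_cast (by omega)) _
  -- The exponents add up to `2k - 2(a + b) = 2s`; `ha` and `hb` exclude truncation.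
  have hkk : (k : ℝ) ^ (k - 2 * a) * k ^ (k - 2 * b) = k ^ (2 * s) := by
    rw [← pow_add]
    congr 1
    omega
  have hfa : (0 : ℝ) < a ! := by exact_mod_cast Nat.factorial_pos a
  have hfb : (0 : ℝ) < b ! := by exact_mod_cast Nat.factorial_pos b
  have hfk : (0 : ℝ) < k ! := by exact_mod_cast Nat.factorial_pos k
  calc _ ≤ ((q : ℝ) ^ k / k ! * (m ^ a / a !) * (m ^ b / b !)) *
        ((k ! * k ^ (k - 2 * a) * m ^ (q - k) / 2 ^ a) *
          (k ! * k ^ (k - 2 * b) * m ^ (q - k) / 2 ^ b)) := by gcongr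
    _ = (q : ℝ) ^ k * (m ^ (a + b) * (m ^ (q - k)) ^ 2) *
        (k ! * (k ^ (k - 2 * a) * k ^ (k - 2 * b))) / (2 ^ (a + b) * (a ! * b !)) := by
      rw [pow_add, pow_add]
      field_simp
    _ ≤ (q : ℝ) ^ k * (m ^ (a + b) * (m ^ (q - k)) ^ 2) *
        ((2 ^ (a + b) * (a ! * b !) * k ^ s) * k ^ (2 * s)) / (2 ^ (a + b) * (a ! * b !)) := by
      rw [hkk]
      gcongr
    _ = (q : ℝ) ^ k * (m ^ (a + b) * (m ^ (q - k)) ^ 2) * k ^ (3 * s) := by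
      rw [show 3 * s = s + 2 * s by ring, pow_add (k : ℝ)]
      field_simp
    _ = _ := by
      obtain ⟨r, rfl⟩ := Nat.exists_eq_add_of_le hkq
      subst hab
      rw [Nat.add_sub_cancel_left, div_pow]
      field_simp
      ring

/-- The number of pairs of hash functions for which some set of keys has few cells. -/
lemma card_exists_card_image_add_le {m q s : ℕ} (hm : 0 < m) (hs : 0 < s) {W : ℝ}
    (hW : ∀ k ≤ q, ((q : ℝ) / m) ^ k * k ^ (3 * s) ≤ W) :
    (({h : HashPair m q | ∃ K : Finset (Fin q),
      (K.image h.1).card + (K.image h.2).card + s ≤ K.card} : Finset (HashPair m q)).card : ℝ) ≤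
      (q + 1) ^ 2 * (m ^ (2 * q) * (W / m ^ s)) := by
  classical
  have hW0 : 0 ≤ W := by
    have := hW 0 (Nat.zero_le _)
    rw [Nat.cast_zero, zero_pow (by omega), mul_zero] at this
    exact this
  -- A pair is `(k, a)`, and `b = k - s - a`; the first filter condition in `J` excludes truncated
  -- subtraction.
  let I : ℕ × ℕ → Finset (Finset (Fin q) × Finset (Fin m) × Finset (Fin m)) := fun y =>
    Finset.powersetCard y.1 Finset.univ ×ˢ (Finset.powersetCard y.2 Finset.univ ×ˢ
      Finset.powersetCard (y.1 - s - y.2) Finset.univ)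
  let J : Finset (ℕ × ℕ) := (Finset.range (q + 1) ×ˢ Finset.range (q + 1)).filter fun y =>
    y.2 + (y.1 - s - y.2) + s = y.1 ∧ 2 * y.2 ≤ y.1 ∧ 2 * (y.1 - s - y.2) ≤ y.1
  have hsub : ({h : HashPair m q | ∃ K : Finset (Fin q),
      (K.image h.1).card + (K.image h.2).card + s ≤ K.card} : Finset (HashPair m q)) ⊆
      J.biUnion fun y => (I y).biUnion fun z => twoCovering z.1 z.2.1 ×ˢ twoCovering z.1 z.2.2 := by
    intro h hh
    obtain ⟨K, hK, h1, h2⟩ := exists_two_le_card_filter h (Finset.mem_filter.1 hh).2 hs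
    have c1 : h.1 ∈ twoCovering K (K.image h.1) := mem_twoCovering.2
      ⟨fun x hx => Finset.mem_image_of_mem _ hx, h1⟩
    have c2 : h.2 ∈ twoCovering K (K.image h.2) := mem_twoCovering.2
      ⟨fun x hx => Finset.mem_image_of_mem _ hx, h2⟩
    have hKq : K.card ≤ q := by simpa using Finset.card_le_univ K
    have d1 := two_mul_card_le_of_twoCovering c1
    have d2 := two_mul_card_le_of_twoCovering c2
    refine Finset.mem_biUnion.2 ⟨(K.card, (K.image h.1).card), ?_, Finset.mem_biUnion.2
      ⟨(K, K.image h.1, K.image h.2), ?_, Finset.mem_product.2 ⟨c1, c2⟩⟩⟩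
    · simp only [J, Finset.mem_filter, Finset.mem_product, Finset.mem_range]
      omega
    · simp only [I, Finset.mem_product, Finset.mem_powersetCard, Finset.subset_univ, true_and]
      omega
  have hterm : ∀ y ∈ J, (((I y).biUnion fun z =>
      twoCovering z.1 z.2.1 ×ˢ twoCovering z.1 z.2.2).card : ℝ) ≤ m ^ (2 * q) * (W / m ^ s) := by
    rintro ⟨k, a⟩ hy
    simp only [J, Finset.mem_filter, Finset.mem_product, Finset.mem_range] at hy
    obtain ⟨⟨hk, -⟩, hab, ha, hb⟩ := hy
    set b := k - s - a
    have hcov : ∀ (K : Finset (Fin q)) (A : Finset (Fin m)), K.card = k →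
        ((twoCovering K A).card : ℝ) ≤
          (k.factorial * A.card ^ (k - 2 * A.card) * m ^ (q - k) / 2 ^ A.card) := by
      rintro K A rfl
      rw [le_div_iff₀ (by positivity)]
      have := card_twoCovering_le K A
      rw [Fintype.card_fin, Fintype.card_fin] at this
      exact_mod_cast this
    calc _ ≤ ∑ z ∈ I (k, a), ((twoCovering z.1 z.2.1 ×ˢ twoCovering z.1 z.2.2).card : ℝ) := by
          exact_mod_cast Finset.card_biUnion_le
      _ ≤ ∑ z ∈ I (k, a), ((k.factorial * a ^ (k - 2 * a) * m ^ (q - k) / 2 ^ a) *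
            (k.factorial * b ^ (k - 2 * b) * m ^ (q - k) / 2 ^ b) : ℝ) := by
          refine Finset.sum_le_sum fun z hz => ?_
          simp only [I, Finset.mem_product, Finset.mem_powersetCard, Finset.subset_univ,
            true_and] at hz
          obtain ⟨z1, z2, z3⟩ := hz
          have e1 := hcov z.1 z.2.1 z1
          have e2 := hcov z.1 z.2.2 z1
          rw [z2] at e1
          rw [z3] at e2
          rw [Finset.card_product, Nat.cast_mul]
          exact mul_le_mul e1 e2 (Nat.cast_nonneg _) (by positivity)
      _ = (q.choose k * m.choose a * m.choose b : ℝ) *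
          ((k.factorial * a ^ (k - 2 * a) * m ^ (q - k) / 2 ^ a) *
            (k.factorial * b ^ (k - 2 * b) * m ^ (q - k) / 2 ^ b)) := by
          rw [Finset.sum_const, nsmul_eq_mul]
          simp only [I, Finset.card_product, Finset.card_powersetCard, Finset.card_univ,
            Fintype.card_fin, Nat.cast_mul, b, mul_assoc]
      _ ≤ _ := card_core_term_le hm (by omega) hab ha hb
      _ ≤ _ := by
          gcongr
          exact hW k (by omega)
  calc _ ≤ ∑ y ∈ J, (((I y).biUnion fun z =>
        twoCovering z.1 z.2.1 ×ˢ twoCovering z.1 z.2.2).card : ℝ) := by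
        exact_mod_cast (Finset.card_le_card hsub).trans Finset.card_biUnion_le
    _ ≤ J.card • ((m : ℝ) ^ (2 * q) * (W / m ^ s)) := Finset.sum_le_card_nsmul _ _ _ hterm
    _ ≤ _ := by
        rw [nsmul_eq_mul]
        gcongr
        have : J.card ≤ (q + 1) ^ 2 := by
          refine (Finset.card_filter_le _ _).trans ?_
          rw [Finset.card_product, Finset.card_range, sq]
        exact_mod_cast this

/-! ### Probability estimates -/

lemma hashProb_eq_card_div {m q : ℕ} (A : Set (HashPair m q)) [DecidablePred (· ∈ A)] :
    hashProb m q A = ({h | h ∈ A} : Finset (HashPair m q)).card / (m : ℝ) ^ (2 * q) := by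
  have hA : A = (({h | h ∈ A} : Finset (HashPair m q)) : Set (HashPair m q)) := by
    ext
    simp
  rw [hashProb, MeasureTheory.measureReal_def, ProbabilityTheory.uniformOn_univ]
  nth_rewrite 1 [hA]
  rw [MeasureTheory.Measure.count_apply_finset, ENNReal.toReal_div, ENNReal.toReal_natCast,
    ENNReal.toReal_natCast, Fintype.card_prod, Fintype.card_fun, Fintype.card_fin, Fintype.card_fin,
    ← pow_add, two_mul, Nat.cast_pow]

/-- An explicit bound, for keys that fill at most a fraction `1 - ε` of the cells of a table. -/
lemma hashProb_le {m q s : ℕ} {ε : ℝ} (hε : 0 < ε) (hm : 0 < m) (hs : 0 < s)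
    (hq : (q : ℝ) ≤ (1 - ε) * m) {A : Set (HashPair m q)}
    (hA : ∀ h ∈ A, ∃ K : Finset (Fin q),
      (K.image h.1).card + (K.image h.2).card + s ≤ K.card) :
    hashProb m q A ≤ (m + 1) ^ 2 * ((3 * s / ε) ^ (3 * s) / m ^ s) := by
  classical
  have hm' : (0 : ℝ) < m := by exact_mod_cast hm
  have hs' : (0 : ℝ) < s := by exact_mod_cast hs
  have hqm : (q : ℝ) ≤ m := hq.trans (by nlinarith)
  have hW : ∀ k ≤ q, ((q : ℝ) / m) ^ k * k ^ (3 * s) ≤ (3 * s / ε) ^ (3 * s) := by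
    intro k _
    have h1 : (q : ℝ) / m ≤ Real.exp (-ε) := by
      rw [div_le_iff₀ hm']
      refine hq.trans ?_
      have := Real.add_one_le_exp (-ε)
      gcongr
      linarith
    -- Raised to the power `3s`, this gives a factor `exp(εk)` that cancels `exp(-ε)^k` exactly.
    have h2 : ε * k / (3 * s) ≤ Real.exp (ε * k / (3 * s)) :=
      (by linarith [Real.add_one_le_exp (ε * k / (3 * s))])
    have h3 : (k : ℝ) = (3 * s / ε) * (ε * k / (3 * s)) := by field_simp
    calc ((q : ℝ) / m) ^ k * k ^ (3 * s)
        = ((q : ℝ) / m) ^ k * ((3 * s / ε) ^ (3 * s) * (ε * k / (3 * s)) ^ (3 * s)) := by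
          rw [← mul_pow, ← h3]
      _ ≤ Real.exp (-ε) ^ k * ((3 * s / ε) ^ (3 * s) *
          Real.exp (ε * k / (3 * s)) ^ (3 * s)) := by gcongr
      _ = (3 * s / ε) ^ (3 * s) *
          (Real.exp (-ε) ^ k * Real.exp (ε * k / (3 * s)) ^ (3 * s)) := by ring
      _ = (3 * s / ε) ^ (3 * s) := by
          rw [← Real.exp_nat_mul, ← Real.exp_nat_mul, ← Real.exp_add]
          push_cast
          rw [show (k : ℝ) * -ε + 3 * s * (ε * k / (3 * s)) = 0 by field_simp; ring]
          simp
  rw [hashProb_eq_card_div, div_le_iff₀ (by positivity)]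
  have hcard := card_exists_card_image_add_le hm hs hW
  calc _ ≤ _ := Nat.cast_le.2 (Finset.card_le_card (Finset.monotone_filter_right _ fun h _ => hA h))
    _ ≤ _ := hcard
    _ ≤ (m + 1) ^ 2 * (m ^ (2 * q) * ((3 * s / ε) ^ (3 * s) / m ^ s)) := by gcongr
    _ = _ := by ring

/-- The explicit bound is at most `m ^ (-s / 7)` for large `m` and `s`. -/
lemma explicit_bound_le_rpow {m s : ℕ} {x R : ℝ} (hx : 0 ≤ x) (hm : 2 ≤ m) (hs : 14 ≤ s)
    (hR : R ^ 3 ≤ m) (hR₀ : 0 ≤ R) (hxm : x ^ 7 ≤ R * m) :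
    ((m : ℝ) + 1) ^ 2 * (x ^ (3 * s) / m ^ s) ≤ (m : ℝ) ^ (-((1 / 7 : ℝ) * s)) := by
  have hm' : (2 : ℝ) ≤ m := by exact_mod_cast hm
  have hm₀ : (0 : ℝ) < m := by linarith
  refine le_of_pow_le_pow_left₀ (n := 7) (by norm_num) (by positivity) ?_
  have h1 : ((m : ℝ) ^ (-((1 / 7 : ℝ) * s))) ^ 7 = 1 / m ^ s := by
    rw [← Real.rpow_mul_natCast hm₀.le, show -((1 / 7 : ℝ) * s) * (7 : ℕ) = -s by push_cast; ring,
      Real.rpow_neg hm₀.le, Real.rpow_natCast, one_div]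
  have h2 : ((m : ℝ) + 1) ^ 14 ≤ m ^ (2 * s) := by
    calc ((m : ℝ) + 1) ^ 14 ≤ (m ^ 2) ^ 14 := by
          gcongr
          nlinarith
      _ = (m : ℝ) ^ 28 := by ring
      _ ≤ _ := pow_le_pow_right₀ (by linarith) (by omega)
  have h3 : (x ^ 7) ^ (3 * s) ≤ m ^ (4 * s) := by
    calc (x ^ 7) ^ (3 * s) ≤ (R * m) ^ (3 * s) := by gcongr
      _ = (R ^ 3) ^ s * m ^ (3 * s) := by ring
      _ ≤ (m : ℝ) ^ s * m ^ (3 * s) := by gcongr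
      _ = _ := by ring
  rw [h1]
  calc (((m : ℝ) + 1) ^ 2 * (x ^ (3 * s) / m ^ s)) ^ 7
      = ((m : ℝ) + 1) ^ 14 * (x ^ 7) ^ (3 * s) / (m : ℝ) ^ (7 * s) := by
        rw [mul_pow, div_pow]
        ring
    _ ≤ (m : ℝ) ^ (2 * s) * (m : ℝ) ^ (4 * s) / (m : ℝ) ^ (7 * s) := by gcongr
    _ = 1 / (m : ℝ) ^ s := by
        field_simp
        ring

/-! ### Asymptotics in `n` -/

theorem mainTheorem7
    -- the keys fill at most a fraction `1 - ε` of the cells of one subtable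
    (ε : ℝ) (hε₀ : 0 < ε) (hε₁ : ε < 1)
    -- constants in `m = Ω(log⁷ n)`, in `m = O(log ^ B n)`, and in `s = Θ(log n)`
    (c₀ : ℝ) (hc₀ : 0 < c₀) (A : ℝ) (B : ℕ) (c₁ c₂ : ℝ) (hc₁ : 0 < c₁) :
    ∃ α : ℝ, 0 < α ∧
      -- overflow has probability `m ^ (-Ω(s))`
      (∃ N : ℕ, ∀ n m s q : ℕ, N ≤ n →
        c₀ * Real.log n ^ 7 ≤ m → (m : ℝ) ≤ A * Real.log n ^ B →
        c₁ * Real.log n ≤ s → (s : ℝ) ≤ c₂ * Real.log n →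
        (q : ℝ) ≤ (1 - ε) * m →
        hashProb m q {h | s + (cuckooGraph h).numCyclicComponents ≤
            (cuckooGraph h).cyclomaticNumber} ≤ (m : ℝ) ^ (-(α * s)) ∧
        hashProb m q {h | ¬ FitsWithStash h s} ≤ (m : ℝ) ^ (-(α * s))) ∧
      -- and this bound is superpolynomially small in `n`
      (∀ D : ℝ, ∃ N : ℕ, ∀ n m s : ℕ, N ≤ n →
        c₀ * Real.log n ^ 7 ≤ m → (m : ℝ) ≤ A * Real.log n ^ B →
        c₁ * Real.log n ≤ s → (s : ℝ) ≤ c₂ * Real.log n →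
        (m : ℝ) ^ (-(α * s)) ≤ (n : ℝ) ^ (-D)) := by
  have hlog : Filter.Tendsto (fun n : ℕ => Real.log n) Filter.atTop Filter.atTop :=
    Real.tendsto_log_atTop.comp tendsto_natCast_atTop_atTop
  have hev : ∀ M : ℝ, ∃ N : ℕ, ∀ n : ℕ, N ≤ n → M ≤ Real.log n := fun M =>
    Filter.eventually_atTop.1 (hlog.eventually_ge_atTop M)
  have hlarge : ∀ {L x M : ℝ}, 1 ≤ L → M / c₀ ≤ L → c₀ * L ^ 7 ≤ x → M ≤ x := by
    intro L x M h1 h2 h3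
    rw [div_le_iff₀ hc₀, mul_comm] at h2
    exact h2.trans (le_trans (by gcongr; exact le_self_pow₀ h1 (by norm_num)) h3)
  refine ⟨1 / 7, by norm_num, ?_, fun D => ?_⟩
  · set R : ℝ := (3 * |c₂| / ε) ^ 7 / c₀ with hRdef
    have hR₀ : 0 ≤ R := by positivity
    obtain ⟨N, hN⟩ := hev (max 1 (max (14 / c₁) (max (2 / c₀) (R ^ 3 / c₀))))
    refine ⟨N, fun n m s q hn hm _ hs hs' hq => ?_⟩
    have hL := hN n hn
    simp only [max_le_iff] at hL
    obtain ⟨hL1, hL2, hL3, hL4⟩ := hL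
    set L := Real.log n
    have hm2 : 2 ≤ m := by exact_mod_cast hlarge hL1 hL3 hm
    have hs14 : 14 ≤ s := by
      rw [div_le_iff₀ hc₁, mul_comm] at hL2
      exact_mod_cast hL2.trans hs
    have hx : (3 * s / ε : ℝ) ^ 7 ≤ R * m := by
      have h1 : (s : ℝ) ≤ |c₂| * L := hs'.trans (by gcongr; exact le_abs_self c₂)
      calc (3 * s / ε : ℝ) ^ 7 ≤ (3 * (|c₂| * L) / ε) ^ 7 := by gcongr
        _ = R * (c₀ * L ^ 7) := by
          rw [hRdef]
          field_simp
        _ ≤ R * m := by gcongr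
    have hb := explicit_bound_le_rpow (by positivity) hm2 hs14 (hlarge hL1 hL4 hm) hR₀ hx
    exact ⟨(hashProb_le hε₀ (by omega) (by omega) hq fun h hh =>
        exists_card_image_add_le_of_cyclomaticNumber h hh).trans hb,
      (hashProb_le hε₀ (by omega) (by omega) hq fun h hh =>
        exists_card_image_add_le_of_not_fitsWithStash h hh).trans hb⟩
  -- The threshold makes `log m ≥ 7|D|/c₁`, so `s log m / 7 ≥ |D| log n`.
  · obtain ⟨N, hN⟩ := hev (max 1 (Real.exp (7 * |D| / c₁) / c₀))
    refine ⟨N, fun n m s hn hm _ hs _ => ?_⟩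
    have hL := hN n hn
    rw [max_le_iff] at hL
    obtain ⟨hL1, hL2⟩ := hL
    have hn₀ : (0 : ℝ) < n := by
      by_contra! h
      rw [le_antisymm h (Nat.cast_nonneg n), Real.log_zero] at hL1
      linarith
    set L := Real.log n with hLdef
    have hexp := hlarge hL1 hL2 hm
    have hm₀ : (0 : ℝ) < m := (Real.exp_pos _).trans_le hexp
    have hlogm : 7 * |D| / c₁ ≤ Real.log m := (Real.le_log_iff_exp_le hm₀).2 hexp
    have hlogm₀ : 0 ≤ Real.log m := le_trans (by positivity) hlogm
    rw [Real.rpow_def_of_pos hm₀, Real.rpow_def_of_pos hn₀, ← hLdef]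
    refine Real.exp_le_exp.2 ?_
    have h1 : |D| * L ≤ Real.log m * (1 / 7 * s) := by
      calc |D| * L = 7 * |D| / c₁ * (1 / 7 * (c₁ * L)) := by field_simp
        _ ≤ Real.log m * (1 / 7 * s) := by gcongr
    have h2 : D * L ≤ |D| * L := by
      gcongr
      exact le_abs_self D
    linarith
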